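/- **Setting.** An sc-Banach space is a Banach space $E=E_0$ with a nested sequence of Banach spaces $E_0\supseteq E_1\supseteq E_2\supseteq\cdots$ such that the inclusions $E_n\hookrightarrow E_m$ ($m<n$) are compact and $E_\infty=\bigcap_m E_m$ is dense in every $E_m$. Direct sums are taken levelwise, $\mathbb R^n$ carries the constant structure, and $E^1$ denotes $E_1$ with levels $(E^1)_m=E_{m+1}$. A partial quadrant is a subset $C$ of an sc-Banach space $W$ for which there are an integer $n\ge 0$, an sc-Banach space $Q$ and a linear sc-isomorphism $T:W\to\mathbb R^n\oplus Q$ with $T(C)=[0,\infty)^n\oplus Q$. For $U$ relatively open in a partial quadrant of $E$ put $U_m=U\cap E_m$ and $TU=U^1\oplus E$. A map $f:U\to F$ is $\mathrm{sc}^0$ if it induces continuous maps $U_m\to F_m$ for all $m\ge 0$. It is $\mathrm{sc}^1$ if it is $\mathrm{sc}^0$, if for each $x\in U_1$ there is a bounded linear map $Df(x):E_0\to F_0$ with $\|f(x+h)-f(x)-Df(x)h\|_0/\|h\|_1\to 0$ as $\|h\|_1\to 0$ ($h\in E_1$, $x+h\in U_1$), and if $Tf:TU\to TF$, $(x,h)\mapsto(f(x),Df(x)h)$,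 is $\mathrm{sc}^0$. It is $\mathrm{sc}^{k+1}$ if it is $\mathrm{sc}^1$ and $Tf$ is $\mathrm{sc}^k$, and sc-smooth if it is $\mathrm{sc}^k$ for all $k$. An sc-smooth splicing $\mathcal S=(\pi,E,V)$ consists of a relatively open subset $V$ of a partial quadrant $C\subseteq W$, an sc-Banach space $E$, and bounded linear projections $\pi_v:E\to E$ ($v\in V$) such that $\Phi:V\oplus E\to E$, $\Phi(v,e)=\pi_v(e)$, is sc-smooth. Its splicing core is $K^{\mathcal S}=\{(v,e)\in V\oplus E:\pi_v(e)=e\}$. The tangent splicing $T\mathcal S=(T\pi,TE,TV)$ is given by $(T\pi)_{(v,\delta v)}(e,\delta e)=(\pi_v(e),D\Phi(v,e)(\delta v,\delta e))$. If $O\subseteq K^{\mathcal S}$ is open, $TO\subseteq K^{T\mathcal S}$ is the open set of those $(v,\delta v,e,\delta e)\in K^{T\mathcal S}$ with $(v,e)\in O$. An $\mathrm{sc}^0$-map $f:O\to O'$ between open subsets of splicing cores is $\mathrm{sc}^1$ if $\hat f(v,e)=f(v,\pi_v(e))$ is $\mathrm{sc}^1$ on $\hat O=\{(v,e)\in V\oplus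 E:(v,\pi_v(e))\in O\}$; then $T\hat f$ (with the coordinates reordered) restricts to $Tf:TO\to TO'$, and $f$ is $\mathrm{sc}^{k+1}$ if it is $\mathrm{sc}^1$ and $Tf$ is $\mathrm{sc}^k$. It is sc-smooth if it is $\mathrm{sc}^k$ for all $k$. An sc-diffeomorphism is a homeomorphism that is sc-smooth together with its inverse. An M-polyfold is a second countable Hausdorff space $X$ with a maximal atlas of charts, each a homeomorphism $\varphi:U\to O$ from an open subset of $X$ onto an open subset of a splicing core, such that all transition maps are sc-smooth. For a point $(v,e)$ of $K^{\mathcal S}$ and a linear sc-isomorphism $T:W\to\mathbb R^n\oplus Q$ with $T(C)=[0,\infty)^n\oplus Q$, the *number of vanishing coordinates* of $(v,e)$ with respect to $T$ is the number of $i\in\{1,\dots,n\}$ for which the $i$-th coordinate of the $\mathbb R^n$-component of $T(v)$ is $0$. **Theorem.** 1. Let $\Psi:O\to O'$ be an sc-diffeomorphism between open subsets of the splicing cores of two sc-smooth splicings, and let $T$ and $T'$ be linear sc-isomorphisms as above for the partial quadrants of the two splicings. Then, for every $p\in O$, the number of vanishing coordinates of $p$ with respect to $T$ equals the number of vanishing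 coordinates of $\Psi(p)$ with respect to $T'$. 2. Let $X$ be an M-polyfold. There is exactly one map $d:X\to\mathbb N$ (the degeneracy index) such that for every $x\in X$, every M-polyfold chart $\varphi$ of $X$ around $x$, and every linear sc-isomorphism $T$ as above for the partial quadrant of that chart, $d(x)$ is the number of vanishing coordinates of $\varphi(x)$ with respect to $T$. Moreover, every $x\in X$ has an open neighborhood $U'$ with $d(y)\le d(x)$ for all $y\in U'$. -/

import Mathlib

open Set Topology

universe u v w

/-- A Banach space `E` with an sc-structure.  The Banach space `E m` is `level m`; the nested
inclusions `E n ⊆ E m` for `m ≤ n` are the injective bounded linear maps `incl`, so `level 0` is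
the underlying Banach space. Inclusions between different levels are compact, and `E_∞` (the
points lying in every level) is dense in each level. -/
structure ScBanach where
  level : ℕ → Type u
  [normed : ∀ m, NormedAddCommGroup (level m)]
  [space : ∀ m, NormedSpace ℝ (level m)]
  [complete : ∀ m, CompleteSpace (level m)]
  incl : ∀ {m n : ℕ}, m ≤ n → (level n →L[ℝ] level m)
  incl_refl : ∀ (m : ℕ) (x : level m), incl (le_refl m) x = x
  incl_trans : ∀ {l m n : ℕ} (h : l ≤ m) (h' : m ≤ n) (x : level n),
    incl h (incl h' x) = incl (h.trans h') x
  incl_injective : ∀ {m n : ℕ} (h : m ≤ n), Function.Injective (incl h)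
  incl_compact : ∀ {m n : ℕ} (h : m < n), IsCompactOperator (incl h.le)
  dense_smooth : ∀ m : ℕ, Dense {x : level m | ∀ (n : ℕ) (h : m ≤ n), x ∈ range (incl h)}

attribute [instance] ScBanach.normed ScBanach.space ScBanach.complete

namespace ScBanach

/-- The inclusion of the level `E m` into the Banach space `E = E 0`. -/
abbrev toBase (E : ScBanach.{u}) (m : ℕ) : E.level m →L[ℝ] E.level 0 :=
  E.incl (Nat.zero_le m)

/-- The points of `U ⊆ E` on level `m`, that is `U ∩ E m`, as a subset of `E m`. -/
abbrev lev (E : ScBanach.{u}) (m : ℕ) (U : Set (E.level 0)) : Set (E.level m) :=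
  {x | E.toBase m x ∈ U}

/-- The sc-Banach space `E^1`, with levels `(E^1) m = E (m + 1)`. -/
abbrev shift (E : ScBanach.{u}) : ScBanach.{u} where
  level m := E.level (m + 1)
  incl h := E.incl (Nat.succ_le_succ h)
  incl_refl m x := E.incl_refl (m + 1) x
  incl_trans _ _ x := E.incl_trans _ _ x
  incl_injective _ := E.incl_injective _
  incl_compact h := E.incl_compact (Nat.succ_lt_succ h)
  dense_smooth m := by
    refine (E.dense_smooth (m + 1)).mono ?_
    intro x hx n h
    exact hx (n + 1) (Nat.succ_le_succ h)

theorem compact_prodMap {A B A' B' : Type*}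
    [NormedAddCommGroup A] [NormedSpace ℝ A] [NormedAddCommGroup B] [NormedSpace ℝ B]
    [NormedAddCommGroup A'] [NormedSpace ℝ A'] [NormedAddCommGroup B'] [NormedSpace ℝ B']
    {f : A →L[ℝ] A'} {g : B →L[ℝ] B'} (hf : IsCompactOperator f) (hg : IsCompactOperator g) :
    IsCompactOperator (f.prodMap g) := by
  have h1 : IsCompactOperator
      ((ContinuousLinearMap.inl ℝ A' B').comp (f.comp (ContinuousLinearMap.fst ℝ A B))) :=
    (hf.comp_clm (ContinuousLinearMap.fst ℝ A B)).clm_comp (ContinuousLinearMap.inl ℝ A' B')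
  have h2 : IsCompactOperator
      ((ContinuousLinearMap.inr ℝ A' B').comp (g.comp (ContinuousLinearMap.snd ℝ A B))) :=
    (hg.comp_clm (ContinuousLinearMap.snd ℝ A B)).clm_comp (ContinuousLinearMap.inr ℝ A' B')
  have h3 := h1.add h2
  have h4 : (f.prodMap g : A × B → A' × B') =
      ((ContinuousLinearMap.inl ℝ A' B').comp (f.comp (ContinuousLinearMap.fst ℝ A B)) : _ → _) +
      ((ContinuousLinearMap.inr ℝ A' B').comp (g.comp (ContinuousLinearMap.snd ℝ A B)) : _ → _) := by
    funext x
    simp [Prod.map]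
  rw [h4]
  exact h3

/-- The direct sum `E ⊕ F`, with levels `E m ⊕ F m`. -/
noncomputable abbrev prod (E : ScBanach.{u}) (F : ScBanach.{v}) : ScBanach.{max u v} where
  level m := E.level m × F.level m
  incl h := (E.incl h).prodMap (F.incl h)
  incl_refl m x := Prod.ext (E.incl_refl m x.1) (F.incl_refl m x.2)
  incl_trans h h' x := Prod.ext (E.incl_trans h h' x.1) (F.incl_trans h h' x.2)
  incl_injective h x y hxy :=
    Prod.ext (E.incl_injective h (congrArg Prod.fst hxy))
      (F.incl_injective h (congrArg Prod.snd hxy))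
  incl_compact h := compact_prodMap (E.incl_compact h) (F.incl_compact h)
  dense_smooth m := by
    refine ((E.dense_smooth m).prod (F.dense_smooth m)).mono ?_
    rintro ⟨x, y⟩ ⟨hx, hy⟩ n h
    obtain ⟨a, ha⟩ := hx n h
    obtain ⟨b, hb⟩ := hy n h
    exact ⟨(a, b), Prod.ext ha hb⟩

/-- `ℝⁿ` with its constant sc-structure. -/
noncomputable abbrev real (n : ℕ) : ScBanach.{0} where
  level _ := Fin n → ℝ
  incl _ := ContinuousLinearMap.id ℝ (Fin n → ℝ)
  incl_refl _ _ := rfl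
  incl_trans _ _ _ := rfl
  incl_injective _ := Function.injective_id
  incl_compact _ :=
    ⟨Metric.closedBall 0 1, isCompact_closedBall _ _, Metric.closedBall_mem_nhds _ one_pos⟩
  dense_smooth m := by simp

/-- The sc-Banach space `TE = E^1 ⊕ E`. -/
noncomputable abbrev tangent (E : ScBanach.{u}) : ScBanach.{u} := E.shift.prod E

/-- The tangent `TU = U^1 ⊕ E` of a subset `U ⊆ E`. -/
def tangentSet (E : ScBanach.{u}) (U : Set (E.level 0)) : Set (E.tangent.level 0) :=
  {p | p.1 ∈ E.lev 1 U}

end ScBanach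

/-- The bounded linear operator `T : E → F` is an sc-operator: it induces bounded linear
operators `E m → F m` on all levels. -/
def IsScOperator {E : ScBanach.{u}} {F : ScBanach.{v}} (T : E.level 0 →L[ℝ] F.level 0) : Prop :=
  ∀ m : ℕ, ∃ Tm : E.level m →L[ℝ] F.level m, ∀ x, F.toBase m (Tm x) = T (E.toBase m x)

/-- Linear sc-isomorphisms. -/
structure ScIso (E : ScBanach.{u}) (F : ScBanach.{v}) where
  equiv : E.level 0 ≃L[ℝ] F.level 0
  isScOperator : IsScOperator (E := E) (F := F) (equiv : E.level 0 →L[ℝ] F.level 0)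
  isScOperator_symm :
    IsScOperator (E := F) (F := E) (equiv.symm : F.level 0 →L[ℝ] E.level 0)

/-! In the next definitions a map defined on a subset `U` of `E` is represented by a total
function `f`, of which only the values on `U` matter. -/

/-- `f : U → F` is of class sc⁰: it maps `U m` into `F m`, continuously, for every `m`. -/
def IsScZero (E F : ScBanach.{u}) (U : Set (E.level 0)) (f : E.level 0 → F.level 0) : Prop :=
  ∀ m : ℕ, ∃ g : E.level m → F.level m,
    (∀ x ∈ E.lev m U, F.toBase m (g x) = f (E.toBase m x)) ∧ ContinuousOn g (E.lev m U)

/-- `Tf : TU → TF` is the tangent map `(x, h) ↦ (f x, Df(x) h)` of `f : U → F`, where, at every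
`x ∈ U 1`, the bounded linear map `Df(x) : E 0 → F 0` is the linearization of `f`: it satisfies
`‖f (x + h) - f x - Df(x) h‖₀ / ‖h‖₁ → 0` as `‖h‖₁ → 0`, for `h ∈ E 1` with `x + h ∈ U 1`. -/
def IsTangentMap (E F : ScBanach.{u}) (U : Set (E.level 0)) (f : E.level 0 → F.level 0)
    (Tf : E.tangent.level 0 → F.tangent.level 0) : Prop :=
  ∀ x ∈ E.lev 1 U, ∃ D : E.level 0 →L[ℝ] F.level 0,
    HasFDerivWithinAt (fun y : E.level 1 => f (E.toBase 1 y)) (D.comp (E.toBase 1))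
      (E.lev 1 U) x ∧
    ∀ h : E.level 0, F.toBase 1 (Tf (x, h)).1 = f (E.toBase 1 x) ∧ (Tf (x, h)).2 = D h

/-- `f : U → F` is of class scᵏ, where `U` is a (relatively) open subset of a partial quadrant
in `E`. -/
def IsScClass : (k : ℕ) → (E F : ScBanach.{u}) → (U : Set (E.level 0)) →
    (f : E.level 0 → F.level 0) → Prop
  | 0, E, F, U, f => IsScZero E F U f
  | k + 1, E, F, U, f => IsScZero E F U f ∧
      ∃ Tf : E.tangent.level 0 → F.tangent.level 0,
        IsTangentMap E F U f Tf ∧ IsScClass k E.tangent F.tangent (E.tangentSet U) Tf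

/-- A linear sc-isomorphism `T : W → ℝⁿ ⊕ Q` mapping `C` onto `[0,∞)ⁿ ⊕ Q`. -/
structure QuadrantChart {W : ScBanach.{u}} (C : Set (W.level 0)) where
  n : ℕ
  Q : ScBanach.{u}
  T : ScIso W ((ScBanach.real n).prod Q)
  image_eq : T.equiv '' C = {p | ∀ i, 0 ≤ p.1 i}

/-- The number of vanishing quadrant coordinates of a point. -/
noncomputable def QuadrantChart.numVanishing {W : ScBanach.{u}} {C : Set (W.level 0)}
    (P : QuadrantChart C) (v : W.level 0) : ℕ :=
  {i : Fin P.n | (P.T.equiv v).1 i = 0}.ncard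

/-- Partial quadrants. -/
def IsPartialQuadrant {W : ScBanach.{u}} (C : Set (W.level 0)) : Prop :=
  Nonempty (QuadrantChart C)

/-- An sc-smooth splicing `(π, E, V)`, with `V` an open subset of the partial quadrant `C ⊆ W`.
(Only the values of `π` on `V` matter.) -/
structure Splicing where
  W : ScBanach.{u}
  E : ScBanach.{u}
  C : Set (W.level 0)
  isPartialQuadrant : IsPartialQuadrant C
  V : Set (W.level 0)
  isOpen_V : ∃ G : Set (W.level 0), IsOpen G ∧ V = C ∩ G
  π : W.level 0 → (E.level 0 →L[ℝ] E.level 0)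
  proj : ∀ v ∈ V, (π v).comp (π v) = π v
  smooth : ∀ k : ℕ, IsScClass k (W.prod E) E (V ×ˢ univ) (fun p => π p.1 p.2)

namespace Splicing

/-- The splicing core `{(v, e) ∈ V ⊕ E | π_v e = e}`. -/
def core (S : Splicing.{u}) : Set ((S.W.prod S.E).level 0) :=
  {p | p.1 ∈ S.V ∧ S.π p.1 p.2 = p.2}

end Splicing

section CoreMaps

/-! For the iterated tangents, a splicing over `V ⊆ W` with fibre `E` enters only through the map
`Φ (v, e) = π_v e`. -/

variable {W E W' E' : ScBanach.{u}}

/-- The set `Ô = {(v, e) ∈ V ⊕ E | (v, π_v e) ∈ O}`. -/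
def hatSet (V : Set (W.level 0)) (Φ : (W.prod E).level 0 → E.level 0)
    (O : Set ((W.prod E).level 0)) : Set ((W.prod E).level 0) :=
  {p | p.1 ∈ V ∧ (p.1, Φ p) ∈ O}

/-- The map `f̂ (v, e) = f (v, π_v e)`. -/
def hatMap (Φ : (W.prod E).level 0 → E.level 0)
    (f : (W.prod E).level 0 → (W'.prod E').level 0) :
    (W.prod E).level 0 → (W'.prod E').level 0 :=
  fun p => f (p.1, Φ p)

/-- The reordering `TW ⊕ TE → T(W ⊕ E)`, `((v, δv), (e, δe)) ↦ ((v, e), (δv, δe))`. -/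
def reorder (q : (W.tangent.prod E.tangent).level 0) : (W.prod E).tangent.level 0 :=
  ((q.1.1, q.2.1), (q.1.2, q.2.2))

/-- The reordering `T(W ⊕ E) → TW ⊕ TE`, `((v, e), (δv, δe)) ↦ ((v, δv), (e, δe))`. -/
def reorderInv (q : (W.prod E).tangent.level 0) : (W.tangent.prod E.tangent).level 0 :=
  ((q.1.1, q.2.1), (q.1.2, q.2.2))

/-- The tangent `TO` of an open subset `O` of the splicing core, where `TΦ` is the tangent map
of `Φ`: the points `(v, δv, e, δe)` with `(v, e) ∈ O^1` and `(Tπ)_{(v, δv)} (e, δe) = (e, δe)`,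
which form a subset of the core of the tangent splicing. -/
def coreTangent (TΦ : (W.prod E).tangent.level 0 → E.tangent.level 0)
    (O : Set ((W.prod E).level 0)) : Set ((W.tangent.prod E.tangent).level 0) :=
  {q | (W.toBase 1 q.1.1, E.toBase 1 q.2.1) ∈ O ∧ TΦ (reorder q) = q.2}

end CoreMaps

/-- The map `f : O → W' ⊕ E'` is of class scᵏ, where `O` is an open subset of the core of the
splicing given by `V ⊆ W`, `E` and `Φ (v, e) = π_v e`.  It is sc¹ if it is sc⁰ and `f̂` is sc¹ on
`Ô`, and it is sc^(k+2) if it is sc¹ and its tangent map `Tf`, the restriction to `TO` of the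
tangent map of `f̂`, is sc^(k+1) on the open subset `TO` of the core of the tangent splicing. -/
def IsCoreScClass : (k : ℕ) → (W E W' E' : ScBanach.{u}) → (V : Set (W.level 0)) →
    (Φ : (W.prod E).level 0 → E.level 0) → (O : Set ((W.prod E).level 0)) →
    (f : (W.prod E).level 0 → (W'.prod E').level 0) → Prop
  | 0, W, E, W', E', _, _, O, f => IsScZero (W.prod E) (W'.prod E') O f
  | 1, W, E, W', E', V, Φ, O, f => IsScZero (W.prod E) (W'.prod E') O f ∧
      IsScClass 1 (W.prod E) (W'.prod E') (hatSet V Φ O) (hatMap Φ f)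
  | k + 2, W, E, W', E', V, Φ, O, f => IsScZero (W.prod E) (W'.prod E') O f ∧
      IsScClass 1 (W.prod E) (W'.prod E') (hatSet V Φ O) (hatMap Φ f) ∧
      ∃ (TΦ : (W.prod E).tangent.level 0 → E.tangent.level 0)
        (F : (W.prod E).tangent.level 0 → (W'.prod E').tangent.level 0),
        IsTangentMap (W.prod E) E (V ×ˢ univ) Φ TΦ ∧
        IsTangentMap (W.prod E) (W'.prod E') (hatSet V Φ O) (hatMap Φ f) F ∧
        IsCoreScClass (k + 1) W.tangent E.tangent W'.tangent E'.tangent (W.tangentSet V)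
          (fun q => TΦ (reorder q)) (coreTangent TΦ O) (fun q => reorderInv (F (reorder q)))

namespace Splicing

/-- The map `f`, on the open subset `O` of the splicing core of `S`, with values in the splicing
core of `S'`, is sc-smooth (that is, of class scᵏ for every `k`). -/
def IsScSmoothOn (S S' : Splicing.{u}) (O : Set S.core) (f : S.core → S'.core) : Prop :=
  ∃ g : (S.W.prod S.E).level 0 → (S'.W.prod S'.E).level 0,
    (∀ p ∈ O, g p = f p) ∧
    ∀ k : ℕ, IsCoreScClass k S.W S.E S'.W S'.E S.V (fun p => S.π p.1 p.2) (Subtype.val '' O) g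

/-- A homeomorphism between open subsets of splicing cores is an sc-diffeomorphism if it and its
inverse are sc-smooth. -/
def IsScDiffeo {S S' : Splicing.{u}} (Ψ : OpenPartialHomeomorph S.core S'.core) : Prop :=
  IsScSmoothOn S S' Ψ.source Ψ ∧ IsScSmoothOn S' S Ψ.target Ψ.symm

end Splicing

/-- An M-polyfold chart: a homeomorphism from an open subset of `X` onto an open subset of a
splicing core. -/
structure PolyfoldChart (X : Type w) [TopologicalSpace X] where
  S : Splicing.{u}
  φ : OpenPartialHomeomorph X S.core

/-- Two charts are compatible if the transition maps, in both directions, are sc-smooth. -/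
def PolyfoldChart.Compatible {X : Type w} [TopologicalSpace X] (c c' : PolyfoldChart.{u} X) :
    Prop :=
  Splicing.IsScDiffeo (c.φ.symm.trans c'.φ)

/-- An M-polyfold structure on `X`: a maximal atlas of compatible M-polyfold charts. -/
structure MPolyfold (X : Type w) [TopologicalSpace X] where
  atlas : Set (PolyfoldChart.{u} X)
  covers : ∀ x : X, ∃ c ∈ atlas, x ∈ c.φ.source
  compatible : ∀ c ∈ atlas, ∀ c' ∈ atlas, c.Compatible c'
  maximal : ∀ c : PolyfoldChart.{u} X,
    (∀ c' ∈ atlas, c.Compatible c' ∧ c'.Compatible c) → c ∈ atlas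

/-- `d` is the degeneracy index: in every chart around `x`, and for every identification of the
partial quadrant `C` of the chart with `[0,∞)ⁿ ⊕ Q`, the number `d x` is the number of vanishing
coordinates in `[0,∞)ⁿ` of the image of `x` in the chart. -/
def MPolyfold.IsDegeneracyIndex {X : Type w} [TopologicalSpace X] (A : MPolyfold.{u} X)
    (d : X → ℕ) : Prop :=
  ∀ c ∈ A.atlas, ∀ x ∈ c.φ.source, ∀ P : QuadrantChart c.S.C,
    d x = P.numVanishing (c.φ x).1.1

open Filter

theorem ScBanach.toBase_zero (E : ScBanach.{u}) (x : E.level 0) : E.toBase 0 x = x :=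
  E.incl_refl 0 x

/-! A splicing core carries no linear tangent structure transverse to its corners, so `Ψ` and its
inverse are replaced by their hat extensions `F` and `F'`. These are sc¹ on relatively open subsets
of corners, and `F ∘ F'` is the retraction `(v, e) ↦ (v, π_v e)`, which leaves the quadrant
coordinates unchanged.

At a point of level `1`, let `I` and `I'` index the vanishing coordinates there and at the image.
Since `F` maps corner to corner, its linearization `D` preserves the inward tangent cones, hence
also their lineality spaces: coordinates in `I'` of `D h` depend only on coordinates in `I` of `h`.
This gives a linear map `A : ℝ^I → ℝ^I'`. Differentiating `F ∘ F'` shows that `A` is onto, so `|I'|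
≤ |I|` (`ncard_vanishing_le_of_corner_maps`). The chain rule is delicate, because the linearization
of `F'` only produces directions of level `0`; `IsTangentMap.tendsto_slope_comp` handles this
through joint continuity of the tangent map.

A general `p` is approximated by level-`1` points `q` with exactly the same quadrant coordinates
(`exists_level_one_mem`). Applying the level-`1` inequality to the inverse at `Ψ q`, together with
upper semicontinuity of the count at `Ψ p`, bounds the count at `p` by that at `Ψ p`; symmetry gives
equality. -/

/-! ### Levels, density and the sc chain rule along curves -/

theorem ScBanach.denseRange_toBase (E : ScBanach.{u}) (m : ℕ) : DenseRange (E.toBase m) := by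
  refine (E.dense_smooth 0).mono ?_
  intro x hx
  exact hx m (Nat.zero_le m)

theorem IsScZero.continuousOn {E F : ScBanach.{u}} {U : Set (E.level 0)}
    {f : E.level 0 → F.level 0} (hf : IsScZero E F U f) : ContinuousOn f U := by
  obtain ⟨g, hg, hc⟩ := hf 0
  have hU : E.lev 0 U = U := by
    ext x
    simp only [ScBanach.lev, mem_ofPred_eq, E.toBase_zero]
  rw [hU] at hg hc
  refine hc.congr fun x hx => ?_
  have := hg x hx
  rwa [F.toBase_zero, E.toBase_zero, eq_comm] at this

/-- The directional chain rule for tangent maps: a curve converging on level `1`, whose difference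
quotients converge on level `0`, is mapped to a curve with the expected one-sided derivative. -/
theorem IsTangentMap.tendsto_slope_comp {E F : ScBanach.{u}} {U : Set (E.level 0)}
    {f : E.level 0 → F.level 0} {Tf : E.tangent.level 0 → F.tangent.level 0}
    (hT : IsTangentMap E F U f Tf) (hc : ContinuousOn Tf (E.tangentSet U))
    {x : E.level 1} (hx : x ∈ E.lev 1 U) {y : ℝ → E.level 1}
    (hy : Tendsto y (𝓝[>] 0) (𝓝 x))
    (hseg : ∀ᶠ t in 𝓝[>] (0 : ℝ), segment ℝ x (y t) ⊆ E.lev 1 U) {k : E.level 0}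
    (hk : Tendsto (fun t : ℝ => t⁻¹ • (E.toBase 1 (y t) - E.toBase 1 x)) (𝓝[>] 0) (𝓝 k)) :
    Tendsto (fun t : ℝ => t⁻¹ • (f (E.toBase 1 (y t)) - f (E.toBase 1 x))) (𝓝[>] 0)
      (𝓝 (Tf (x, k)).2) := by
  rw [Metric.tendsto_nhds]
  intro ε hε
  have hcx : ContinuousWithinAt (fun p => (Tf p).2) (E.tangentSet U) (x, k) :=
    (continuous_snd.continuousOn.comp hc (mapsTo_univ _ _)) (x, k) hx
  obtain ⟨δ, hδ, hδε⟩ := Metric.continuousWithinAt_iff.1 hcx (ε / 2) (half_pos hε)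
  filter_upwards [hseg, Metric.tendsto_nhds.1 hy δ hδ, Metric.tendsto_nhds.1 hk δ hδ]
    with t hs hyt hkt
  set γ : ℝ → E.level 1 := fun s => x + s • (y t - x) with hγ
  have hγU : ∀ s ∈ Icc (0 : ℝ) 1, γ s ∈ E.lev 1 U := fun s hs' =>
    hs (by rw [segment_eq_image']; exact ⟨s, hs', rfl⟩)
  have hγd : ∀ s ∈ Icc (0 : ℝ) 1, dist (γ s) x < δ := by
    intro s hs'
    rw [dist_eq_norm] at hyt ⊢
    simp only [hγ, add_sub_cancel_left, norm_smul, Real.norm_eq_abs, abs_of_nonneg hs'.1]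
    exact (mul_le_of_le_one_left (norm_nonneg _) hs'.2).trans_lt hyt
  -- Mean value inequality along the segment from `x` to `y t`. The linearizations need not vary
  -- continuously in operator norm; joint continuity of `Tf` at `(x, k)`, in level `1` times level
  -- `0`, is what makes this derivative small.
  have hderiv : ∀ s ∈ Icc (0 : ℝ) 1, HasDerivWithinAt
      (fun s => t⁻¹ • f (E.toBase 1 (γ s)) - s • (Tf (x, k)).2)
      ((Tf (γ s, t⁻¹ • (E.toBase 1 (y t) - E.toBase 1 x))).2 - (Tf (x, k)).2) (Icc 0 1) s := by
    intro s hs'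
    obtain ⟨D, hD, hDT⟩ := hT (γ s) (hγU s hs')
    have h1 : HasDerivWithinAt γ (y t - x) (Icc 0 1) s := by
      have h := ((hasDerivWithinAt_id s (Icc (0 : ℝ) 1)).smul_const (y t - x)).const_add x
      rwa [one_smul] at h
    have h2 := (hD.comp_hasDerivWithinAt s h1 hγU).const_smul t⁻¹
    have h3 := (hasDerivWithinAt_id s (Icc (0 : ℝ) 1)).smul_const (Tf (x, k)).2
    refine (h2.sub h3).congr_deriv ?_
    rw [(hDT _).2, one_smul, map_smul, ContinuousLinearMap.comp_apply, map_sub]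
  have hbound : ∀ s ∈ Icc (0 : ℝ) 1,
      ‖(Tf (γ s, t⁻¹ • (E.toBase 1 (y t) - E.toBase 1 x))).2 - (Tf (x, k)).2‖ ≤ ε / 2 := by
    intro s hs'
    rw [← dist_eq_norm]
    refine (hδε (x := (γ s, t⁻¹ • (E.toBase 1 (y t) - E.toBase 1 x))) (hγU s hs') ?_).le
    exact max_lt (hγd s hs') hkt
  have key := (convex_Icc (0 : ℝ) 1).norm_image_sub_le_of_norm_hasDerivWithin_le hderiv hbound
    (left_mem_Icc.2 zero_le_one) (right_mem_Icc.2 zero_le_one)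
  have h0 : γ 0 = x := by simp [hγ]
  have h1 : γ 1 = y t := by simp [hγ]
  rw [h0, h1] at key
  rw [dist_eq_norm, smul_sub]
  refine lt_of_le_of_lt (le_trans (le_of_eq ?_) key) (by simpa using hε)
  congr 1
  simp only [one_smul, zero_smul, sub_zero]
  abel

/-! ### Tangent cones of corners -/

/-- A relatively open piece of a corner `{z | 0 ≤ L z}` absorbs small multiples of the directions
pointing into the corner. -/
theorem eventually_add_smul_mem_corner {E : ScBanach.{u}} {n : ℕ}
    {L : E.level 0 →L[ℝ] (Fin n → ℝ)} {G U : Set (E.level 0)} (hG : IsOpen G)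
    (hU : U = {z | ∀ i, 0 ≤ L z i} ∩ G) {x : E.level 1} (hx : x ∈ E.lev 1 U) {h : E.level 1}
    (hh : ∀ i, L (E.toBase 1 x) i = 0 → 0 ≤ L (E.toBase 1 h) i) :
    ∀ᶠ t in 𝓝[>] (0 : ℝ), x + t • h ∈ E.lev 1 U := by
  subst hU
  have hcont : Tendsto (fun t : ℝ => E.toBase 1 (x + t • h)) (𝓝[>] 0) (𝓝 (E.toBase 1 x)) := by
    have : Continuous (fun t : ℝ => E.toBase 1 (x + t • h)) := by fun_prop
    simpa using (this.tendsto 0).mono_left nhdsWithin_le_nhds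
  have hpos : ∀ i, ∀ᶠ t in 𝓝[>] (0 : ℝ), 0 ≤ L (E.toBase 1 (x + t • h)) i := by
    intro i
    rcases (hx.1 i).eq_or_lt with h0 | h0
    · filter_upwards [self_mem_nhdsWithin] with t ht
      simp only [map_add, map_smul, Pi.add_apply, Pi.smul_apply, ← h0, zero_add, smul_eq_mul]
      exact mul_nonneg (le_of_lt ht) (hh i h0.symm)
    · have := ((continuous_apply i).comp L.continuous).continuousAt.tendsto.comp hcont
      exact (this.eventually (lt_mem_nhds h0)).mono fun t ht => le_of_lt ht
  filter_upwards [eventually_all.2 hpos, hcont.eventually (hG.mem_nhds hx.2)] with t h1 h2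
  exact ⟨h1, h2⟩

/-- The corner is convex but `G` need not be; near `x` it is replaced by a ball. -/
theorem eventually_segment_subset_corner {E : ScBanach.{u}} {n : ℕ}
    {L : E.level 0 →L[ℝ] (Fin n → ℝ)} {G U : Set (E.level 0)} (hG : IsOpen G)
    (hU : U = {z | ∀ i, 0 ≤ L z i} ∩ G) {x : E.level 1} (hx : x ∈ E.lev 1 U)
    {y : ℝ → E.level 1} (hy : Tendsto y (𝓝[>] 0) (𝓝 x))
    (hyU : ∀ᶠ t in 𝓝[>] (0 : ℝ), y t ∈ E.lev 1 U) :
    ∀ᶠ t in 𝓝[>] (0 : ℝ), segment ℝ x (y t) ⊆ E.lev 1 U := by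
  subst hU
  obtain ⟨r, hr, hball⟩ := Metric.isOpen_iff.1 (hG.preimage (E.toBase 1).continuous) x hx.2
  filter_upwards [hyU, hy.eventually (Metric.ball_mem_nhds x hr)] with t h1 h2
  have hconv : Convex ℝ ({z : E.level 1 | ∀ i, 0 ≤ L (E.toBase 1 z) i} ∩ Metric.ball x r) := by
    refine Convex.inter ?_ (convex_ball x r)
    intro a ha b hb s t hs ht _ i
    simp only [map_add, map_smul, Pi.add_apply, Pi.smul_apply, smul_eq_mul]
    exact add_nonneg (mul_nonneg hs (ha i)) (mul_nonneg ht (hb i))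
  intro z hz
  have hz' := hconv.segment_subset ⟨hx.1, Metric.mem_ball_self hr⟩ ⟨h1.1, h2⟩ hz
  exact ⟨hz'.1, hball hz'.2⟩

theorem tendsto_slope_line {E F : ScBanach.{u}} {U : Set (E.level 0)}
    {f : E.level 0 → F.level 0} {x h : E.level 1} {D : E.level 0 →L[ℝ] F.level 0}
    (hD : HasFDerivWithinAt (fun y : E.level 1 => f (E.toBase 1 y)) (D.comp (E.toBase 1))
      (E.lev 1 U) x)
    (hh : ∀ᶠ t in 𝓝[>] (0 : ℝ), x + t • h ∈ E.lev 1 U) :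
    Tendsto (fun t : ℝ => t⁻¹ • (f (E.toBase 1 (x + t • h)) - f (E.toBase 1 x))) (𝓝[>] 0)
      (𝓝 (D (E.toBase 1 h))) := by
  refine hD.lim (c := fun t : ℝ => t⁻¹) (d := fun t : ℝ => t • h) ?_ hh ?_
  · have : Continuous (fun t : ℝ => t • h) := by fun_prop
    simpa using (this.tendsto 0).mono_left nhdsWithin_le_nhds
  · refine tendsto_const_nhds.congr' ?_
    filter_upwards [self_mem_nhdsWithin] with t ht
    rw [inv_smul_smul₀ (ne_of_gt (mem_Ioi.1 ht))]

/-- Let `f` and `f'` be sc¹ maps between relatively open subsets of the corners `{0 ≤ L}` and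
`{0 ≤ L'}` such that `f ∘ f'` preserves `L'`. At a point of level `1` fixed by `f' ∘ f`, the map
`f` does not increase the number of vanishing corner coordinates. -/
theorem ncard_vanishing_le_of_corner_maps {E F : ScBanach.{u}} {n n' : ℕ}
    {L : E.level 0 →L[ℝ] (Fin n → ℝ)} {σ : (Fin n → ℝ) →L[ℝ] E.level 1}
    (hσ : ∀ r, L (E.toBase 1 (σ r)) = r)
    {L' : F.level 0 →L[ℝ] (Fin n' → ℝ)} {σ' : (Fin n' → ℝ) →L[ℝ] F.level 1}
    (hσ' : ∀ r, L' (F.toBase 1 (σ' r)) = r)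
    {G U : Set (E.level 0)} (hG : IsOpen G) (hU : U = {z | ∀ i, 0 ≤ L z i} ∩ G)
    {G' U' : Set (F.level 0)} (hG' : IsOpen G') (hU' : U' = {z | ∀ i, 0 ≤ L' z i} ∩ G')
    {f : E.level 0 → F.level 0} {f' : F.level 0 → E.level 0}
    (hf : IsScClass 1 E F U f) (hf' : IsScClass 1 F E U' f')
    (hfU : MapsTo f U U') (hfU' : MapsTo f' U' U)
    (hff' : ∀ z ∈ U', L' (f (f' z)) = L' z)
    {x : E.level 1} (hx : x ∈ E.lev 1 U)
    (hfx : f' (f (E.toBase 1 x)) = E.toBase 1 x) :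
    {i | L' (f (E.toBase 1 x)) i = 0}.ncard ≤ {i | L (E.toBase 1 x) i = 0}.ncard := by
  obtain ⟨hf0, Tf, hTf, hTf0⟩ := hf
  obtain ⟨hf0', Tf', hTf', -⟩ := hf'
  obtain ⟨f₁, hf₁, -⟩ := hf0 1
  obtain ⟨f₁', hf₁', hf₁c'⟩ := hf0' 1
  set x' : F.level 1 := f₁ x
  have hx'eq : F.toBase 1 x' = f (E.toBase 1 x) := hf₁ x hx
  have hx' : x' ∈ F.lev 1 U' := by
    change F.toBase 1 x' ∈ U'
    rw [hx'eq]
    exact hfU hx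
  have hback : f₁' x' = x := by
    apply E.incl_injective (Nat.zero_le 1)
    change E.toBase 1 _ = E.toBase 1 _
    rw [hf₁' x' hx', hx'eq, hfx]
  obtain ⟨D, hD, hDT⟩ := hTf x hx
  obtain ⟨D', hD', -⟩ := hTf' x' hx'
  -- Where a coordinate of `f x` vanishes, the difference quotients of that coordinate along `x + t
  -- h` are nonnegative, and so is their limit.
  have hcone : ∀ h : E.level 1, (∀ i, L (E.toBase 1 x) i = 0 → 0 ≤ L (E.toBase 1 h) i) →
      ∀ i, L' (f (E.toBase 1 x)) i = 0 → 0 ≤ L' (D (E.toBase 1 h)) i := by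
    intro h hh i hi
    have hmem := eventually_add_smul_mem_corner hG hU hx hh
    have hlim := tendsto_slope_line hD hmem
    have hlim' := ((continuous_apply i).comp L'.continuous).continuousAt.tendsto.comp hlim
    refine ge_of_tendsto hlim' ?_
    filter_upwards [hmem, self_mem_nhdsWithin] with t ht htpos
    have h1 : f (E.toBase 1 (x + t • h)) ∈ U' := hfU ht
    rw [hU'] at h1
    simp only [Function.comp_apply, map_smul, map_sub, Pi.smul_apply, Pi.sub_apply, hi, sub_zero,
      smul_eq_mul]
    exact mul_nonneg (inv_nonneg.2 (le_of_lt htpos)) (h1.1 i)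
  -- The cone property is applied to both `h` and `-h`.
  have hker : ∀ h : E.level 1, (∀ i, L (E.toBase 1 x) i = 0 → L (E.toBase 1 h) i = 0) →
      ∀ i, L' (f (E.toBase 1 x)) i = 0 → L' (D (E.toBase 1 h)) i = 0 := by
    intro h hh i hi
    have h1 := hcone h (fun j hj => (hh j hj).ge) i hi
    have h2 := hcone (-h) (fun j hj => by simp [hh j hj]) i hi
    simp only [map_neg, Pi.neg_apply] at h2
    linarith
  -- For `r ≥ 0` the ray `x' + t σ' r` stays in the corner for small `t > 0`. Its image under `f'`
  -- converges to `x` on level `1`, but its difference quotients are controlled only on level `0`,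
  -- as the chain rule along curves allows.
  have hsurj : ∀ r : Fin n' → ℝ, (∀ i, 0 ≤ r i) → L' (D (D' (F.toBase 1 (σ' r)))) = r := by
    intro r hr
    have hmem := eventually_add_smul_mem_corner (h := σ' r) hG' hU' hx'
      (fun i _ => by rw [hσ']; exact hr i)
    have hline : Tendsto (fun t : ℝ => x' + t • σ' r) (𝓝[>] 0) (𝓝[F.lev 1 U'] x') := by
      refine tendsto_nhdsWithin_iff.2 ⟨?_, hmem⟩
      have : Continuous (fun t : ℝ => x' + t • σ' r) := by fun_prop
      simpa using (this.tendsto 0).mono_left nhdsWithin_le_nhds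
    have hy : Tendsto (fun t : ℝ => f₁' (x' + t • σ' r)) (𝓝[>] 0) (𝓝 x) := by
      have := (hf₁c' x' hx').tendsto.comp hline
      rwa [hback] at this
    have hyU : ∀ᶠ t in 𝓝[>] (0 : ℝ), f₁' (x' + t • σ' r) ∈ E.lev 1 U := by
      filter_upwards [hmem] with t ht
      rw [hf₁' _ ht]
      exact hfU' ht
    have hslope := tendsto_slope_line hD' hmem
    have hslope' : Tendsto (fun t : ℝ => t⁻¹ • (E.toBase 1 (f₁' (x' + t • σ' r)) -
        E.toBase 1 x)) (𝓝[>] 0) (𝓝 (D' (F.toBase 1 (σ' r)))) := by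
      refine hslope.congr' ?_
      filter_upwards [hmem] with t ht
      rw [hf₁' _ ht, hx'eq, hfx]
    have hchain := hTf.tendsto_slope_comp hTf0.continuousOn hx hy
      (eventually_segment_subset_corner hG hU hx hy hyU) hslope'
    rw [(hDT _).2] at hchain
    refine tendsto_nhds_unique ((L'.continuous.tendsto _).comp hchain) ?_
    refine tendsto_const_nhds.congr' ?_
    filter_upwards [hmem, self_mem_nhdsWithin] with t ht htpos
    simp only [Function.comp_apply]
    rw [hf₁' _ ht, map_smul, map_sub, hff' _ ht, ← hx'eq, map_add, map_add, map_smul, map_smul,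
      hσ', add_sub_cancel_left, inv_smul_smul₀ (ne_of_gt htpos)]
  let I := {i // L (E.toBase 1 x) i = 0}
  let I' := {i // L' (f (E.toBase 1 x)) i = 0}
  let B : E.level 0 →ₗ[ℝ] (I' → ℝ) :=
    (LinearMap.funLeft ℝ ℝ (Subtype.val : I' → Fin n')) ∘ₗ (L' ∘L D : E.level 0 →ₗ[ℝ] (Fin n' → ℝ))
  let A : (I → ℝ) →ₗ[ℝ] (I' → ℝ) :=
    B ∘ₗ (E.toBase 1 ∘L σ : (Fin n → ℝ) →ₗ[ℝ] E.level 0) ∘ₗ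
      Function.ExtendByZero.linearMap ℝ (Subtype.val : I → Fin n)
  -- `hker` speaks only of level `1`, whereas surjectivity needs level-`0` directions `D' (σ' r)`.
  -- Both sides are continuous on level `0`, so density suffices; on level `1`, subtracting the
  -- section of the `I`-coordinates lands in the scope of `hker`.
  have hBA : ∀ z : E.level 0, B z = A (fun i => L z i.1) := by
    have hB : Continuous B := by
      refine continuous_pi fun i => ?_
      exact (continuous_apply i.1).comp (L'.comp D).continuous
    have hA : Continuous fun z : E.level 0 => A (fun i => L z i.1) := by
      refine A.continuous_of_finiteDimensional.comp (continuous_pi fun i => ?_)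
      exact (continuous_apply i.1).comp L.continuous
    refine fun z => congrFun ((E.denseRange_toBase 1).equalizer hB hA (funext fun h => ?_)) z
    funext i
    have hk := hker (h - σ (Function.ExtendByZero.linearMap ℝ (Subtype.val : I → Fin n)
      (fun i => L (E.toBase 1 h) i.1))) ?_ i.1 i.2
    · simp only [map_sub, Pi.sub_apply, sub_eq_zero] at hk
      exact hk
    · intro j hj
      rw [map_sub, map_sub, hσ, Pi.sub_apply, sub_eq_zero]
      exact (Subtype.val_injective.extend_apply (fun i : I => L (E.toBase 1 h) i.1) 0 ⟨j, hj⟩).symm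
  -- The standard basis vectors are nonnegative, so `hsurj` reaches each of them.
  have hAsurj : Function.Surjective A := by
    rw [← LinearMap.range_eq_top, eq_top_iff, ← (Pi.basisFun ℝ I').span_eq, Submodule.span_le]
    rintro _ ⟨i, rfl⟩
    refine ⟨_, (hBA (D' (F.toBase 1 (σ' (Pi.single i.1 1))))).symm.trans ?_⟩
    funext j
    have h1 := hsurj (Pi.single i.1 1) (fun j => by
      by_cases hj : j = i.1
      · subst hj; simp
      · simp [hj])
    change L' (D (D' (F.toBase 1 (σ' (Pi.single i.1 1))))) j.1 = _
    rw [h1]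
    simp [Pi.single_apply, Subtype.val_inj]
  have hfin := LinearMap.finrank_le_finrank_of_surjective hAsurj
  rw [Module.finrank_fintype_fun_eq_card, Module.finrank_fintype_fun_eq_card,
    ← Nat.card_eq_fintype_card, ← Nat.card_eq_fintype_card] at hfin
  exact hfin

/-! ### Quadrant coordinates -/

namespace QuadrantChart

variable {W : ScBanach.{u}} {C : Set (W.level 0)}

/-- The quadrant coordinates `W → ℝⁿ`. -/
noncomputable def coord (P : QuadrantChart C) : W.level 0 →L[ℝ] (Fin P.n → ℝ) :=
  (ContinuousLinearMap.fst ℝ (Fin P.n → ℝ) (P.Q.level 0)).comp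
    (P.T.equiv : W.level 0 →L[ℝ] ((ScBanach.real P.n).prod P.Q).level 0)

theorem mem_iff (P : QuadrantChart C) (v : W.level 0) : v ∈ C ↔ ∀ i, 0 ≤ P.coord v i := by
  have h : P.T.equiv v ∈ P.T.equiv '' C ↔ v ∈ C := P.T.equiv.injective.mem_set_image
  rw [← h, P.image_eq]
  rfl

/-- The inverse of `T` is an sc-operator and `ℝⁿ` has the constant structure, so coordinates can be
prescribed by vectors of level `1`. -/
theorem exists_section (P : QuadrantChart C) :
    ∃ σ : (Fin P.n → ℝ) →L[ℝ] W.level 1, ∀ r, P.coord (W.toBase 1 (σ r)) = r := by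
  obtain ⟨R, hR⟩ := P.T.isScOperator_symm 1
  refine ⟨R.comp (ContinuousLinearMap.inl ℝ (Fin P.n → ℝ) (P.Q.level 1)), fun r => ?_⟩
  have h := hR (r, 0)
  change (P.T.equiv (W.toBase 1 (R (r, 0)))).1 = r
  rw [h]
  change (P.T.equiv (P.T.equiv.symm _)).1 = r
  rw [ContinuousLinearEquiv.apply_symm_apply]
  rfl

theorem numVanishing_congr (P : QuadrantChart C) {v w : W.level 0} (h : P.coord v = P.coord w) :
    P.numVanishing v = P.numVanishing w := by
  change {i | P.coord v i = 0}.ncard = {i | P.coord w i = 0}.ncard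
  rw [h]

/-- The number of vanishing coordinates is upper semicontinuous. -/
theorem eventually_numVanishing_le (P : QuadrantChart C) (v : W.level 0) :
    ∀ᶠ w in 𝓝 v, P.numVanishing w ≤ P.numVanishing v := by
  have h : ∀ i, ∀ᶠ w in 𝓝 v, P.coord w i = 0 → P.coord v i = 0 := by
    intro i
    by_cases hi : P.coord v i = 0
    · exact Eventually.of_forall fun _ _ => hi
    · have hc : ContinuousAt (fun w => P.coord w i) v :=
        ((continuous_apply i).comp P.coord.continuous).continuousAt
      filter_upwards [hc.eventually_ne hi] with w hw h0
      exact absurd h0 hw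
  filter_upwards [eventually_all.2 h] with w hw
  exact ncard_le_ncard (fun i hi => hw i hi) (toFinite _)

end QuadrantChart

/-! ### Splicing cores and sc-diffeomorphisms -/

namespace Splicing

theorem continuousOn_proj (S : Splicing.{u}) :
    ContinuousOn (fun p : (S.W.prod S.E).level 0 => S.π p.1 p.2) (S.V ×ˢ univ) :=
  IsScZero.continuousOn (E := S.W.prod S.E) (S.smooth 0)

theorem proj_mem_core (S : Splicing.{u}) {p : (S.W.prod S.E).level 0} (hp : p.1 ∈ S.V) :
    (p.1, S.π p.1 p.2) ∈ S.core :=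
  ⟨hp, congrArg (fun A : S.E.level 0 →L[ℝ] S.E.level 0 => A p.2) (S.proj p.1 hp)⟩

/-- The domain `Ô` attached to an open subset `O` of the splicing core. -/
def hat (S : Splicing.{u}) (O : Set S.core) : Set ((S.W.prod S.E).level 0) :=
  hatSet (W := S.W) (E := S.E) S.V (fun p => S.π p.1 p.2) (Subtype.val '' O)

/-- `Ô` is the preimage of `O` under the continuous retraction `(v, e) ↦ (v, π_v e)`, hence
relatively open in `V ⊕ E`; the fibre variable adds no inequalities. -/
theorem hat_eq_corner (S : Splicing.{u}) {O : Set S.core} (hO : IsOpen O)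
    (P : QuadrantChart S.C) :
    ∃ G : Set ((S.W.prod S.E).level 0), IsOpen G ∧
      S.hat O = {z | ∀ i, 0 ≤ P.coord z.1 i} ∩ G := by
  obtain ⟨N, hN, rfl⟩ := isOpen_induced_iff.1 hO
  obtain ⟨GV, hGV, hV⟩ := S.isOpen_V
  have hr : ContinuousOn (fun p : (S.W.prod S.E).level 0 => (p.1, S.π p.1 p.2))
      (S.V ×ˢ univ) := continuous_fst.continuousOn.prodMk S.continuousOn_proj
  obtain ⟨G, hG, hGeq⟩ := continuousOn_iff'.1 hr N hN
  refine ⟨G ∩ Prod.fst ⁻¹' GV, hG.inter (hGV.preimage continuous_fst), ?_⟩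
  ext z
  have hz : z ∈ S.hat (Subtype.val ⁻¹' N) ↔ z.1 ∈ S.V ∧ (z.1, S.π z.1 z.2) ∈ N := by
    constructor
    · rintro ⟨h1, q, hq, h2⟩
      exact ⟨h1, h2 ▸ hq⟩
    · rintro ⟨h1, h2⟩
      exact ⟨h1, ⟨_, S.proj_mem_core h1⟩, h2, rfl⟩
  have hz' := Set.ext_iff.1 hGeq z
  have hVz : z.1 ∈ S.V ↔ (∀ i, 0 ≤ P.coord z.1 i) ∧ z.1 ∈ GV := by
    rw [hV, mem_inter_iff, P.mem_iff]
  rw [hz]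
  simp only [mem_inter_iff, mem_preimage, mem_prod, mem_univ, and_true] at hz'
  constructor
  · rintro ⟨h1, h2⟩
    exact ⟨(hVz.1 h1).1, (hz'.1 ⟨h2, h1⟩).1, (hVz.1 h1).2⟩
  · rintro ⟨h1, h2, h3⟩
    exact ⟨hVz.2 ⟨h1, h3⟩, (hz'.2 ⟨h2, hVz.2 ⟨h1, h3⟩⟩).1⟩

theorem IsScDiffeo.symm {S S' : Splicing.{u}} {Ψ : OpenPartialHomeomorph S.core S'.core}
    (h : IsScDiffeo Ψ) : IsScDiffeo Ψ.symm :=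
  ⟨h.2, h.1⟩

/-- Trades a map on the core for an sc¹ map on a corner domain that takes the same values after
retraction. -/
theorem IsScSmoothOn.exists_hat {S S' : Splicing.{u}} {O : Set S.core} {f : S.core → S'.core}
    (hf : IsScSmoothOn S S' O f) :
    ∃ F : (S.W.prod S.E).level 0 → (S'.W.prod S'.E).level 0,
      IsScClass 1 (S.W.prod S.E) (S'.W.prod S'.E) (S.hat O) F ∧
      ∀ z ∈ S.hat O, ∃ q ∈ O, q.1 = (z.1, S.π z.1 z.2) ∧ F z = (f q).1 := by
  obtain ⟨g, hg, hk⟩ := hf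
  refine ⟨_, (hk 1).2, ?_⟩
  rintro z ⟨-, q, hq, hqz⟩
  refine ⟨q, hq, hqz, ?_⟩
  rw [← hg q hq, hqz]
  rfl

theorem mem_hat (S : Splicing.{u}) {O : Set S.core} {p : S.core} (hp : p ∈ O) :
    p.1 ∈ S.hat O :=
  ⟨p.2.1, p, hp, Prod.ext rfl p.2.2.symm⟩

/-- At points of level `1`, an sc-diffeomorphism does not increase the number of vanishing
coordinates. -/
theorem IsScDiffeo.numVanishing_le_of_level_one {S S' : Splicing.{u}}
    {Ψ : OpenPartialHomeomorph S.core S'.core} (h : IsScDiffeo Ψ)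
    (P : QuadrantChart S.C) (P' : QuadrantChart S'.C) {p : S.core} (hp : p ∈ Ψ.source)
    {x : (S.W.prod S.E).level 1} (hx : (S.W.prod S.E).toBase 1 x = p.1) :
    P'.numVanishing (Ψ p).1.1 ≤ P.numVanishing p.1.1 := by
  obtain ⟨F, hF, hFq⟩ := h.1.exists_hat
  obtain ⟨F', hF', hFq'⟩ := h.2.exists_hat
  obtain ⟨G, hG, hU⟩ := S.hat_eq_corner Ψ.open_source P
  obtain ⟨G', hG', hU'⟩ := S'.hat_eq_corner Ψ.open_target P'
  obtain ⟨σ, hσ⟩ := P.exists_section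
  obtain ⟨σ', hσ'⟩ := P'.exists_section
  have hval : ∀ q ∈ Ψ.source, F q.1 = (Ψ q).1 := by
    intro q hq
    obtain ⟨r, -, hr, hFr⟩ := hFq q.1 (S.mem_hat hq)
    have hrq : r = q := Subtype.ext (hr.trans (Prod.ext rfl q.2.2))
    rw [hFr, hrq]
  have hval' : ∀ q ∈ Ψ.target, F' q.1 = (Ψ.symm q).1 := by
    intro q hq
    obtain ⟨r, -, hr, hFr⟩ := hFq' q.1 (S'.mem_hat hq)
    have hrq : r = q := Subtype.ext (hr.trans (Prod.ext rfl q.2.2))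
    rw [hFr, hrq]
  have hmaps : MapsTo F (S.hat Ψ.source) (S'.hat Ψ.target) := by
    intro z hz
    obtain ⟨q, hq, -, hFz⟩ := hFq z hz
    rw [hFz]
    exact S'.mem_hat (Ψ.map_source hq)
  have hmaps' : MapsTo F' (S'.hat Ψ.target) (S.hat Ψ.source) := by
    intro z hz
    obtain ⟨q, hq, -, hFz⟩ := hFq' z hz
    rw [hFz]
    exact S.mem_hat (Ψ.map_target hq)
  have hpx : (S.W.prod S.E).toBase 1 x ∈ S.hat Ψ.source := by
    rw [hx]
    exact S.mem_hat hp
  have hfix : F' (F ((S.W.prod S.E).toBase 1 x)) = (S.W.prod S.E).toBase 1 x := by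
    rw [hx, hval p hp, hval' _ (Ψ.map_source hp), Ψ.left_inv hp]
  have key := ncard_vanishing_le_of_corner_maps (E := S.W.prod S.E) (F := S'.W.prod S'.E)
    (L := P.coord.comp (ContinuousLinearMap.fst ℝ (S.W.level 0) (S.E.level 0)))
    (L' := P'.coord.comp (ContinuousLinearMap.fst ℝ (S'.W.level 0) (S'.E.level 0)))
    (σ := (ContinuousLinearMap.inl ℝ (S.W.level 1) (S.E.level 1)).comp σ)
    (σ' := (ContinuousLinearMap.inl ℝ (S'.W.level 1) (S'.E.level 1)).comp σ')
    (fun r => hσ r) (fun r => hσ' r) hG hU hG' hU' hF hF' hmaps hmaps' ?_ hpx hfix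
  · rw [hx, hval p hp] at key
    exact key
  -- `F ∘ F'` is the retraction onto the core, which fixes the base point `v`.
  · intro z hz
    obtain ⟨q, hq, hqz, hFz⟩ := hFq' z hz
    rw [hFz, hval _ (Ψ.map_target hq), Ψ.right_inv hq, hqz]
    rfl

/-- The points of level `1` with the same quadrant coordinates as `p` accumulate at `p`. -/
theorem exists_level_one_mem (S : Splicing.{u}) (P : QuadrantChart S.C) (p : S.core)
    {N : Set S.core} (hN : N ∈ 𝓝 p) :
    ∃ q ∈ N, P.coord q.1.1 = P.coord p.1.1 ∧
      ∃ x : (S.W.prod S.E).level 1, (S.W.prod S.E).toBase 1 x = q.1 := by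
  obtain ⟨σ, hσ⟩ := P.exists_section
  obtain ⟨GV, hGV, hV⟩ := S.isOpen_V
  obtain ⟨O, hO, hON⟩ := mem_nhds_induced Subtype.val p N |>.1 hN
  obtain ⟨Φ₁, hΦ₁, -⟩ := S.smooth 0 1
  -- The section corrects any base point to have the coordinates of `p`. It takes values in level
  -- `1`, so the correction `c` preserves that level, where it is `c₁`; membership in `C` is then
  -- automatic.
  let c₁ : S.W.level 1 → S.W.level 1 := fun w => w + σ (P.coord p.1.1 - P.coord (S.W.toBase 1 w))
  let c : S.W.level 0 → S.W.level 0 :=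
    fun w => w + S.W.toBase 1 (σ (P.coord p.1.1 - P.coord w))
  have hc : Continuous c := by fun_prop
  have hcp : c p.1.1 = p.1.1 := by simp [c]
  have hcc : ∀ w, P.coord (c w) = P.coord p.1.1 := by
    intro w
    simp only [c]
    rw [map_add, hσ, add_sub_cancel]
  have hcC : ∀ w, c w ∈ S.C := by
    intro w
    rw [P.mem_iff, hcc, ← P.mem_iff]
    exact (hV ▸ p.2.1 : p.1.1 ∈ S.C ∩ GV).1
  -- Correct the base point, then project the fibre. `Θ` fixes `p` and is continuous near it, so a
  -- level-`1` point close to `p` is sent to a core point close to `p`, again of level `1` because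
  -- `Φ` is sc⁰.
  let Θ : (S.W.prod S.E).level 0 → (S.W.prod S.E).level 0 := fun z => (c z.1, S.π (c z.1) z.2)
  have hcont : ContinuousOn Θ {z | c z.1 ∈ S.V} := by
    have h1 : Continuous fun z : (S.W.prod S.E).level 0 => (c z.1, z.2) :=
      (hc.comp continuous_fst).prodMk continuous_snd
    exact (hc.comp continuous_fst).continuousOn.prodMk
      (S.continuousOn_proj.comp h1.continuousOn fun z hz => ⟨hz, mem_univ _⟩)
  have hopen : {z : (S.W.prod S.E).level 0 | c z.1 ∈ S.V} ∈ 𝓝 p.1 := by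
    have : {z : (S.W.prod S.E).level 0 | c z.1 ∈ S.V} = (fun z => c z.1) ⁻¹' GV := by
      ext z
      change c z.1 ∈ S.V ↔ c z.1 ∈ GV
      rw [hV]
      exact ⟨fun h => h.2, fun h => ⟨hcC _, h⟩⟩
    rw [this]
    refine (hGV.preimage (hc.comp continuous_fst)).mem_nhds ?_
    change c p.1.1 ∈ GV
    rw [hcp]
    exact (hV ▸ p.2.1 : p.1.1 ∈ S.C ∩ GV).2
  have hΘp : Θ p.1 = p.1 := by
    simp only [Θ, hcp]
    exact Prod.ext rfl p.2.2
  have hnear : ∀ᶠ z in 𝓝 p.1, Θ z ∈ O := by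
    have := (hcont.continuousAt hopen).tendsto
    rw [hΘp] at this
    exact this hO
  obtain ⟨_, ⟨x, rfl⟩, hzV, hzO⟩ :=
    ((S.W.prod S.E).denseRange_toBase 1).inter_nhds_nonempty (inter_mem hopen hnear)
  have hcV : c (S.W.toBase 1 x.1) ∈ S.V := hzV
  have hc₁ : S.W.toBase 1 (c₁ x.1) = c (S.W.toBase 1 x.1) := by simp [c, c₁]
  refine ⟨⟨_, S.proj_mem_core (p := (c (S.W.toBase 1 x.1), S.E.toBase 1 x.2)) hcV⟩, hON hzO,
    hcc _, (c₁ x.1, Φ₁ (c₁ x.1, x.2)), Prod.ext hc₁ ?_⟩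
  have hc₁V : S.W.toBase 1 (c₁ x.1) ∈ S.V := hc₁ ▸ hcV
  have h := hΦ₁ (c₁ x.1, x.2) ⟨hc₁V, mem_univ _⟩
  refine h.trans ?_
  change S.π (S.W.toBase 1 (c₁ x.1)) (S.E.toBase 1 x.2) = _
  rw [hc₁]

theorem eventually_numVanishing_le (S : Splicing.{u}) (P : QuadrantChart S.C) (p : S.core) :
    ∀ᶠ q in 𝓝 p, P.numVanishing q.1.1 ≤ P.numVanishing p.1.1 :=
  (continuous_fst.comp continuous_subtype_val).continuousAt.eventually
    (P.eventually_numVanishing_le p.1.1)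

/-- sc-smooth maps between splicing cores preserve the points of level `1`. -/
theorem IsScSmoothOn.exists_level_one {S S' : Splicing.{u}} {O : Set S.core}
    {f : S.core → S'.core} (hf : IsScSmoothOn S S' O f) {p : S.core} (hp : p ∈ O)
    (h : ∃ x : (S.W.prod S.E).level 1, (S.W.prod S.E).toBase 1 x = p.1) :
    ∃ y : (S'.W.prod S'.E).level 1, (S'.W.prod S'.E).toBase 1 y = (f p).1 := by
  obtain ⟨x, hx⟩ := h
  obtain ⟨g, hg, hk⟩ := hf
  obtain ⟨g₁, hg₁, -⟩ := hk 0 1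
  exact ⟨g₁ x, (hg₁ x ⟨p, hp, hx.symm⟩).trans (hx ▸ hg p hp)⟩

/-- Passing to a nearby level-`1` point `q` does not change the count at the source, and can only
lower the count at the target. This dictates the direction of the inequality, and hence the use of
the inverse at `Ψ q`. -/
theorem IsScDiffeo.numVanishing_le {S S' : Splicing.{u}}
    {Ψ : OpenPartialHomeomorph S.core S'.core} (h : IsScDiffeo Ψ)
    (P : QuadrantChart S.C) (P' : QuadrantChart S'.C) {p : S.core} (hp : p ∈ Ψ.source) :
    P.numVanishing p.1.1 ≤ P'.numVanishing (Ψ p).1.1 := by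
  have hN : ∀ᶠ q in 𝓝 p, q ∈ Ψ.source ∧
      P'.numVanishing (Ψ q).1.1 ≤ P'.numVanishing (Ψ p).1.1 :=
    (Ψ.open_source.eventually_mem hp).and
      ((Ψ.continuousAt hp).eventually (S'.eventually_numVanishing_le P' _))
  obtain ⟨q, ⟨hq, hqp⟩, hcoord, hlevel⟩ := S.exists_level_one_mem P p hN
  obtain ⟨y, hy⟩ := h.1.exists_level_one hq hlevel
  have hle := h.symm.numVanishing_le_of_level_one P' P (Ψ.map_source hq) hy
  rw [Ψ.left_inv hq, P.numVanishing_congr hcoord] at hle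
  exact hle.trans hqp

/-- sc-diffeomorphisms between open subsets of splicing cores preserve the number of vanishing
quadrant coordinates. -/
theorem IsScDiffeo.numVanishing_eq {S S' : Splicing.{u}}
    {Ψ : OpenPartialHomeomorph S.core S'.core} (h : IsScDiffeo Ψ)
    (P : QuadrantChart S.C) (P' : QuadrantChart S'.C) {p : S.core} (hp : p ∈ Ψ.source) :
    P.numVanishing p.1.1 = P'.numVanishing (Ψ p).1.1 := by
  refine (h.numVanishing_le P P' hp).antisymm ?_
  have hle := h.symm.numVanishing_le P' P (Ψ.map_source hp)
  rwa [Ψ.left_inv hp] at hle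

end Splicing

/-! ### The degeneracy index of an M-polyfold -/

namespace MPolyfold

variable {X : Type w} [TopologicalSpace X] (A : MPolyfold.{u} X)

theorem numVanishing_chart_eq {c c' : PolyfoldChart.{u} X} (hc : c ∈ A.atlas) (hc' : c' ∈ A.atlas)
    {x : X} (hx : x ∈ c.φ.source) (hx' : x ∈ c'.φ.source) (P : QuadrantChart c.S.C)
    (P' : QuadrantChart c'.S.C) :
    P.numVanishing (c.φ x).1.1 = P'.numVanishing (c'.φ x).1.1 := by
  have h := (A.compatible c hc c' hc').numVanishing_eq P P' (p := c.φ x) (by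
    rw [OpenPartialHomeomorph.trans_source]
    refine ⟨c.φ.map_source hx, ?_⟩
    rwa [mem_preimage, c.φ.left_inv hx])
  rwa [OpenPartialHomeomorph.trans_apply, c.φ.left_inv hx] at h

/-- Any choice of a chart and quadrant identification at each point defines the index; invariance
under transition maps makes the choice immaterial. -/
theorem existsUnique_isDegeneracyIndex : ∃! d : X → ℕ, A.IsDegeneracyIndex d := by
  choose c hc hx using A.covers
  let P : ∀ x, QuadrantChart (c x).S.C := fun x => (c x).S.isPartialQuadrant.some
  refine ⟨fun x => (P x).numVanishing ((c x).φ x).1.1, ?_, ?_⟩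
  · intro c' hc' x hx' P'
    exact A.numVanishing_chart_eq (hc x) hc' (hx x) hx' (P x) P'
  · intro d hd
    funext x
    exact hd (c x) (hc x) x (hx x) (P x)

theorem IsDegeneracyIndex.exists_open_le {A : MPolyfold.{u} X} {d : X → ℕ}
    (hd : A.IsDegeneracyIndex d) (x : X) : ∃ U : Set X, IsOpen U ∧ x ∈ U ∧ ∀ y ∈ U, d y ≤ d x := by
  obtain ⟨c, hc, hx⟩ := A.covers x
  let P : QuadrantChart c.S.C := c.S.isPartialQuadrant.some
  have hev : ∀ᶠ y in 𝓝 x, d y ≤ d x := by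
    filter_upwards [c.φ.open_source.mem_nhds hx,
      (c.φ.continuousAt hx).eventually (c.S.eventually_numVanishing_le P _)] with y hy hle
    rwa [hd c hc y hy P, hd c hc x hx P]
  obtain ⟨U, hU, hUo, hxU⟩ := eventually_nhds_iff.1 hev
  exact ⟨U, hUo, hxU, hU⟩

end MPolyfold

theorem theorem3 :
    (∀ (S S' : Splicing.{u}) (Ψ : OpenPartialHomeomorph S.core S'.core),
      Splicing.IsScDiffeo Ψ →
      ∀ (P : QuadrantChart S.C) (P' : QuadrantChart S'.C), ∀ p ∈ Ψ.source,
        P.numVanishing p.1.1 = P'.numVanishing (Ψ p).1.1) ∧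
    (∀ (X : Type w) [TopologicalSpace X] [T2Space X] [SecondCountableTopology X]
      (A : MPolyfold.{u} X),
      (∃! d : X → ℕ, A.IsDegeneracyIndex d) ∧
      ∀ d : X → ℕ, A.IsDegeneracyIndex d →
        ∀ x : X, ∃ U : Set X, IsOpen U ∧ x ∈ U ∧ ∀ y ∈ U, d y ≤ d x) := by
  refine ⟨fun S S' Ψ h P P' p hp => h.numVanishing_eq P P' hp, ?_⟩
  intro X _ _ _ A
  exact ⟨A.existsUnique_isDegeneracyIndex, fun d hd x => hd.exists_open_le x⟩
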